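/- **Proposition 2.5.** Let $d\ge 1$, let $\|\cdot\|$ be an arbitrary norm on $\mathbb R^d$, and let $r>0$. Let $P$ be a Borel probability measure on $\mathbb R^d$ that is absolutely continuous with respect to Lebesgue measure and satisfies $\int \|x\|^{r+\delta}\,dP(x)<\infty$ for some $\delta>0$. For $n\in\mathbb N=\{1,2,\dots\}$ let $$e_{n,r}=\inf\Big\{\Big(\int\|x-q(x)\|^r\,dP(x)\Big)^{1/r}\ :\ q:\mathbb R^d\to\mathbb R^d \text{ Borel measurable},\ \operatorname{card}(q(\mathbb R^d))\le n\Big\}$$ be the $n$-th level $L^r(P)$-quantization error. Then $$e^r_{n,r}-e^r_{n+1,r}\ \approx\ n^{-(1+r/d)},$$ that is, the sequence of ratios is bounded and bounded away from $0$: there are constants $0<c\le C<\infty$ (which may depend on $d,\|\cdot\|,r,P$ but not on $n$) such that $$c\le \frac{e^r_{n,r}-e^r_{n+1,r}}{n^{-(1+r/d)}}\le C\qquad\text{for all } n\ge 1.$$ -/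

import Mathlib

open MeasureTheory
open scoped ENNReal

noncomputable section

/-- The `n`-th level `L^r(P)`-quantization error `e_{n,r}(P)`: the infimum of
`(∫ ‖x - q x‖ ^ r dP(x)) ^ (1 / r)` over all Borel maps `q : E → E` with at most `n` values.
It is an extended nonnegative number, finite for `n ≥ 1` if `P` has a finite `r`-th moment. -/
def quantizationError {E : Type*} [NormedAddCommGroup E] [MeasurableSpace E]
    (P : Measure E) (r : ℝ) (n : ℕ) : ℝ≥0∞ :=
  ⨅ (q : E → E) (_ : Measurable q) (_ : (Set.range q).encard ≤ (n : ℕ∞)),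
    (∫⁻ x, ‖x - q x‖ₑ ^ r ∂P) ^ (1 / r)

/-- `a_n ≈ b_n` for real sequences indexed by the integers `n ≥ 1`: the sequence of ratios
`a_n / b_n` is bounded and bounded away from `0` (by a positive constant from below). -/
def WeaklyAsymptotic (a b : ℕ → ℝ) : Prop :=
  ∃ c C : ℝ, 0 < c ∧ ∀ n : ℕ, 1 ≤ n → c ≤ a n / b n ∧ a n / b n ≤ C

end

/-! Both bounds compare quantizers with `n` and `n + 1` values, at length scale `n ^ (-1/d)`.

Adding a value: `n` balls of radius `s`, a small multiple of `n ^ (-1/d)`, cannot cover a set of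
positive volume on which `P` charges small balls at least like volume. So some `y` in that set is
farther than `s` from every value; using `y` on the ball of radius `s / 4` saves order `s ^ r * s ^
d`, that is `n ^ (-(1 + r/d))` (`exists_add_quantizationError_succ_rpow_le`).

Removing a value: the moment condition gives error `O(n ^ (-r/d))`
(`exists_quantizationError_rpow_le`). By absolute continuity this forces a near-optimal quantizer to
keep order `n` values in a fixed ball (`exists_half_rpow_le_lintegral`). By averaging, one of them
has a cell of mass `O(1/n)` and cost `O(n ^ (-(1 + r/d)))`, and another value within `O(n ^
(-1/d))`. Merging its cell into that neighbour is cheap enough (`quantizationError_rpow_le_add`). -/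

theorem quantizationError_rpow {E : Type*} [NormedAddCommGroup E] [MeasurableSpace E]
    (P : Measure E) {r : ℝ} (hr : 0 < r) (n : ℕ) :
    quantizationError P r n ^ r =
      ⨅ (q : E → E) (_ : Measurable q) (_ : (Set.range q).encard ≤ (n : ℕ∞)),
        ∫⁻ x, ‖x - q x‖ₑ ^ r ∂P := by
  have h (x : ℝ≥0∞) : ENNReal.orderIsoRpow r hr x = x ^ r := rfl
  rw [quantizationError, ← h]
  simp_rw [OrderIso.map_iInf, h, ← ENNReal.rpow_mul, one_div_mul_cancel hr.ne', ENNReal.rpow_one]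

theorem quantizationError_rpow_le {E : Type*} [NormedAddCommGroup E] [MeasurableSpace E]
    (P : Measure E) {r : ℝ} (hr : 0 < r) {n : ℕ} {q : E → E} (hq : Measurable q)
    (hn : (Set.range q).encard ≤ n) :
    quantizationError P r n ^ r ≤ ∫⁻ x, ‖x - q x‖ₑ ^ r ∂P := by
  rw [quantizationError_rpow P hr]
  exact iInf_le_of_le q (iInf_le_of_le hq (iInf_le_of_le hn le_rfl))

theorem exists_lintegral_lt_of_quantizationError_rpow_lt {E : Type*} [NormedAddCommGroup E]
    [MeasurableSpace E] (P : Measure E) {r : ℝ} (hr : 0 < r) {n : ℕ} {t : ℝ≥0∞}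
    (ht : quantizationError P r n ^ r < t) :
    ∃ q : E → E, Measurable q ∧ (Set.range q).encard ≤ n ∧ ∫⁻ x, ‖x - q x‖ₑ ^ r ∂P < t := by
  rw [quantizationError_rpow P hr] at ht
  simpa only [iInf_lt_iff, exists_prop] using ht

theorem exists_measurable_nearest {E : Type*} [NormedAddCommGroup E]
    [MeasurableSpace E] [BorelSpace E] [SecondCountableTopology E] {T : Finset E} (hT : T.Nonempty) :
    ∃ q : E → E, Measurable q ∧ (∀ x, q x ∈ T) ∧ ∀ x, ∀ a ∈ T, ‖x - q x‖ ≤ ‖x - a‖ := by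
  classical
  induction hT using Finset.Nonempty.cons_induction with
  | singleton a => exact ⟨fun _ => a, measurable_const, by simp, by simp⟩
  | cons a s ha hs ih =>
    obtain ⟨q, hq, hqs, hle⟩ := ih
    refine ⟨fun x => if ‖x - a‖ < ‖x - q x‖ then a else q x, ?_, ?_, ?_⟩
    · exact Measurable.ite (measurableSet_lt (by fun_prop) (by fun_prop)) measurable_const hq
    · intro x
      dsimp only
      split_ifs <;> simp [hqs]
    · intro x b hb
      rw [Finset.mem_cons] at hb
      rcases hb with rfl | hb
      · dsimp only
        split_ifs with h
        · exact le_rfl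
        · exact not_lt.1 h
      · dsimp only
        split_ifs with h
        · exact h.le.trans (hle x b hb)
        · exact hle x b hb

/-! ### A priori bound of order `n ^ (-r/d)` from the moment condition -/

/-- Packing argument with radius growing like `(1 + ‖x‖) ^ β`. In a maximal disjoint family every
ball carries mass at least a constant times `ε ^ d` for the finite weight `(1 + ‖x‖) ^ (-β d)`,
which bounds the cardinality; maximality gives the cover. Points whose radius exceeds `1 + ‖x‖` are
served by the origin. -/
theorem exists_finset_weighted_cover {E : Type*} [NormedAddCommGroup E] [NormedSpace ℝ E]
    [FiniteDimensional ℝ E] [Nontrivial E] [MeasurableSpace E] [BorelSpace E]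
    (lam : Measure E) [lam.IsAddHaarMeasure] {β : ℝ} (hβ : 1 < β) :
    ∃ C D : ℝ, 0 < C ∧ 0 < D ∧ ∀ ε : ℝ, 0 < ε → ∃ T : Finset E,
      (T.card : ℝ) * ε ^ Module.finrank ℝ E ≤ C ∧
      ∀ x : E, ‖x‖ ≤ D * (ε * (1 + ‖x‖) ^ β) ∨ ∃ a ∈ T, ‖x - a‖ ≤ D * (ε * (1 + ‖x‖) ^ β) := by
  classical
  set d := Module.finrank ℝ E with hd
  have hd0 : 0 < d := Module.finrank_pos
  have hβ0 : 0 < β := one_pos.trans hβ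
  set g : E → ℝ := fun x => (1 + ‖x‖) ^ (-(β * d)) with hg
  have hgi : Integrable g lam :=
    integrable_one_add_norm (by have : (0 : ℝ) < d := by exact_mod_cast hd0
                                nlinarith)
  have hg0 : ∀ x, 0 ≤ g x := fun x => by positivity
  set v := lam.real (Metric.closedBall (0 : E) 1) with hv
  have hv0 : 0 < v := by
    rw [hv, measureReal_def, ENNReal.toReal_pos_iff]
    exact ⟨Metric.measure_closedBall_pos lam _ one_pos, measure_closedBall_lt_top⟩
  set c₁ : ℝ := (3 / 2) ^ (-(β * d)) * (1 / 2) ^ d * v with hc₁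
  have hc₁0 : 0 < c₁ := by positivity
  set M := ∫ x, g x ∂lam with hM
  have hM0 : 0 ≤ M := integral_nonneg hg0
  refine ⟨M / c₁ + 1, 1 + 3 ^ β, by positivity, by positivity, fun ε hε => ?_⟩
  set w : E → ℝ := fun x => ε * (1 + ‖x‖) ^ β with hw
  have hw0 : ∀ x, 0 < w x := fun x => by positivity
  set B : E → Set E := fun x => Metric.closedBall x (w x / 2) with hB
  have hcomp : ∀ x, w x ≤ 1 + ‖x‖ → ∀ y ∈ B x,
      1 + ‖y‖ ≤ 3 / 2 * (1 + ‖x‖) ∧ 1 + ‖x‖ ≤ 2 * (1 + ‖y‖) := by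
    intro x hx y hy
    have hy' : ‖y - x‖ ≤ w x / 2 := by simpa [hB, dist_eq_norm] using hy
    have h1 := norm_sub_norm_le y x
    have h2 := norm_sub_norm_le x y
    rw [norm_sub_rev] at h2
    constructor <;> linarith
  have hball : ∀ x, w x ≤ 1 + ‖x‖ → c₁ * ε ^ d ≤ ∫ y in B x, g y ∂lam := by
    intro x hx
    have h1 : ∫ y in B x, (3 / 2 * (1 + ‖x‖)) ^ (-(β * d)) ∂lam ≤ ∫ y in B x, g y ∂lam := by
      refine setIntegral_mono_on ?_ hgi.integrableOn Metric.isClosed_closedBall.measurableSet ?_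
      · exact integrableOn_const measure_closedBall_lt_top.ne
      · intro y hy
        exact Real.rpow_le_rpow_of_nonpos (by positivity) (hcomp x hx y hy).1
          (by have : 0 ≤ β * d := by positivity
              linarith)
    refine le_trans (le_of_eq ?_) h1
    rw [setIntegral_const, smul_eq_mul, hB, Measure.addHaar_real_closedBall' lam x (by positivity),
      ← hv, ← hd, hw, hc₁, Real.mul_rpow (by positivity) (by positivity), div_pow, div_pow, one_pow,
      mul_pow, ← Real.rpow_natCast ((1 + ‖x‖) ^ β), ← Real.rpow_mul (by positivity),
      Real.rpow_neg (x := 1 + ‖x‖) (by positivity)]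
    have : (1 + ‖x‖) ^ (β * d) ≠ 0 := by positivity
    field_simp
  let good : Finset E → Prop := fun T =>
    (∀ x ∈ T, w x ≤ 1 + ‖x‖) ∧ (T : Set E).PairwiseDisjoint B
  have hcard : ∀ T, good T → (T.card : ℝ) * ε ^ d ≤ M / c₁ := by
    intro T hT
    have h1 : ∑ x ∈ T, ∫ y in B x, g y ∂lam ≤ M := by
      rw [← integral_biUnion_finset T (fun x _ => Metric.isClosed_closedBall.measurableSet) hT.2
        (fun x _ => hgi.integrableOn)]
      exact setIntegral_le_integral hgi (Filter.Eventually.of_forall hg0)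
    have h2 : (T.card : ℝ) * (c₁ * ε ^ d) ≤ M := by
      refine le_trans ?_ h1
      rw [← nsmul_eq_mul]
      exact Finset.card_nsmul_le_sum _ _ _ fun x hx => hball x (hT.1 x hx)
    rw [le_div_iff₀ hc₁0]
    linarith
  have hεd : 0 < ε ^ d := by positivity
  obtain ⟨T, hT, hmax⟩ : ∃ T, good T ∧ ∀ T', good T' → T'.card ≤ T.card := by
    have hne : {k | ∃ T, good T ∧ T.card = k}.Nonempty := ⟨0, ∅, by simp [good], rfl⟩
    have hbdd : BddAbove {k | ∃ T, good T ∧ T.card = k} := by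
      refine ⟨⌊M / c₁ / ε ^ d⌋₊, ?_⟩
      rintro _ ⟨T, hT, rfl⟩
      exact Nat.le_floor ((le_div_iff₀ hεd).2 (hcard T hT))
    obtain ⟨T, hT, hk⟩ := Nat.sSup_mem hne hbdd
    exact ⟨T, hT, fun T' hT' => hk ▸ le_csSup hbdd ⟨T', hT', rfl⟩⟩
  refine ⟨T, (hcard T hT).trans (by linarith), fun x => ?_⟩
  have h3 : 0 < (3 : ℝ) ^ β := by positivity
  change ‖x‖ ≤ (1 + 3 ^ β) * w x ∨ ∃ a ∈ T, ‖x - a‖ ≤ (1 + 3 ^ β) * w x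
  rcases lt_or_ge (1 + ‖x‖) (w x) with hx | hx
  · left
    nlinarith [hw0 x]
  right
  by_contra! hcon
  have hdis : ∀ a ∈ T, Disjoint (B x) (B a) := by
    intro a ha
    rw [Set.disjoint_left]
    intro y hyx hya
    have hwa : w a ≤ 3 ^ β * w x := by
      have h : 1 + ‖a‖ ≤ 3 * (1 + ‖x‖) := by
        linarith [(hcomp x hx y hyx).1, (hcomp a (hT.1 a ha) y hya).2]
      calc w a ≤ ε * (3 * (1 + ‖x‖)) ^ β := by
            simp only [hw]
            gcongr
        _ = 3 ^ β * w x := by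
            rw [Real.mul_rpow (by positivity) (by positivity)]
            ring
    have hxa : ‖x - a‖ ≤ w x / 2 + w a / 2 := by
      have h1 : dist x y ≤ w x / 2 := by rw [dist_comm]; exact hyx
      have h2 : dist y a ≤ w a / 2 := hya
      rw [← dist_eq_norm]
      linarith [dist_triangle x y a]
    have := hcon a ha
    nlinarith [hw0 x]
  have hxT : x ∉ T := by
    intro hxT
    have := hdis x hxT
    rw [disjoint_self] at this
    exact (Metric.nonempty_closedBall.2 (by have := hw0 x; positivity)).ne_empty this
  have : good (insert x T) := by
    refine ⟨?_, ?_⟩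
    · simpa [hx] using hT.1
    · rw [Finset.coe_insert]
      exact hT.2.insert fun a ha _ => hdis a ha
  have := hmax _ this
  rw [Finset.card_insert_of_notMem hxT] at this
  omega

theorem exists_quantizationError_rpow_le {E : Type*} [NormedAddCommGroup E] [NormedSpace ℝ E]
    [FiniteDimensional ℝ E] [Nontrivial E] [MeasurableSpace E] [BorelSpace E]
    (P : Measure E) [IsProbabilityMeasure P] {r δ : ℝ} (hr : 0 < r) (hδ : 0 < δ)
    (hmom : Integrable (fun x : E => ‖x‖ ^ (r + δ)) P) :
    ∃ C : ℝ, 0 < C ∧ ∀ n : ℕ, 1 ≤ n →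
      quantizationError P r n ^ r ≤
        ENNReal.ofReal (C * (n : ℝ) ^ (-(r / (Module.finrank ℝ E : ℝ)))) := by
  classical
  set d := Module.finrank ℝ E with hd
  have hd0 : (0 : ℝ) < d := by exact_mod_cast Module.finrank_pos (R := ℝ) (M := E)
  have hd1 : d ≠ 0 := by exact_mod_cast hd0.ne'
  have := FiniteDimensional.proper ℝ E
  -- This `β` satisfies `β * r = r + δ`, so the `r`-th power of the covering radius is integrable.
  obtain ⟨C, D, hC, hD, hcov⟩ := exists_finset_weighted_cover (E := E) Measure.addHaar
    (β := 1 + δ / r) (by linarith [div_pos hδ hr])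
  set G : E → ℝ := fun x => (1 + ‖x‖) ^ (r + δ) with hG
  have hG0 : ∀ x, 0 ≤ G x := fun x => by positivity
  have hGi : Integrable G P := by
    refine Integrable.mono' (((integrable_const (1 : ℝ)).add hmom).const_mul (2 ^ (r + δ)))
      (Measurable.aestronglyMeasurable (by fun_prop)) (Filter.Eventually.of_forall fun x => ?_)
    rw [Real.norm_of_nonneg (hG0 x)]
    have hle : 1 + ‖x‖ ≤ 2 * max 1 ‖x‖ := by linarith [le_max_left 1 ‖x‖, le_max_right 1 ‖x‖]
    calc G x ≤ (2 * max 1 ‖x‖) ^ (r + δ) := by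
          simp only [hG]
          gcongr
      _ = 2 ^ (r + δ) * (max 1 ‖x‖) ^ (r + δ) := Real.mul_rpow (by positivity) (by positivity)
      _ ≤ _ := by
          have : (max 1 ‖x‖) ^ (r + δ) ≤ 1 + ‖x‖ ^ (r + δ) := by
            rcases max_choice 1 ‖x‖ with h | h <;> rw [h]
            · rw [Real.one_rpow]
              linarith [show 0 ≤ ‖x‖ ^ (r + δ) by positivity]
            · linarith
          simp only [Pi.add_apply]
          gcongr
  set M := ∫ x, G x ∂P with hM
  have hM0 : 0 ≤ M := integral_nonneg hG0
  refine ⟨D ^ r * ((2 * C) ^ (r / d) * M) + 1, by positivity, fun n hn => ?_⟩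
  have hn0 : (0 : ℝ) < n := by exact_mod_cast hn
  -- This `ε` gives `T.card ≤ n / 2`, leaving room for the extra value `0`, even when `n = 1`.
  set ε : ℝ := (2 * C / n) ^ (1 / (d : ℝ)) with hε
  have hε0 : 0 < ε := by positivity
  have hεd : ε ^ d = 2 * C / n := by
    rw [hε, ← Real.rpow_natCast, ← Real.rpow_mul (by positivity), one_div_mul_cancel hd0.ne',
      Real.rpow_one]
  have hεr : ε ^ r = (2 * C) ^ (r / d) * (n : ℝ) ^ (-(r / (d : ℝ))) := by
    rw [hε, ← Real.rpow_mul (by positivity), Real.div_rpow (by positivity) hn0.le,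
      Real.rpow_neg hn0.le, one_div_mul_eq_div, div_eq_mul_inv]
  obtain ⟨T, hTc, hT⟩ := hcov ε hε0
  have hcard : (insert 0 T).card ≤ n := by
    refine (Finset.card_insert_le _ _).trans ?_
    have : (T.card : ℝ) ≤ n / 2 := by
      rw [← hd, hεd] at hTc
      have : (T.card : ℝ) * (2 * C) ≤ C * n := by
        calc (T.card : ℝ) * (2 * C) = T.card * (2 * C / n) * n := by field_simp
          _ ≤ C * n := by gcongr
      nlinarith
    have : 2 * T.card ≤ n := by
      have : (2 : ℝ) * T.card ≤ n := by linarith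
      exact_mod_cast this
    omega
  obtain ⟨q, hq, hqT, hqle⟩ := exists_measurable_nearest (Finset.insert_nonempty (0 : E) T)
  have hrange : (Set.range q).encard ≤ n := by
    calc (Set.range q).encard ≤ ((insert 0 T : Finset E) : Set E).encard :=
          Set.encard_le_encard (Set.range_subset_iff.2 hqT)
      _ ≤ n := by
        rw [Set.encard_coe_eq_coe_finsetCard]
        exact_mod_cast hcard
  have hqb : ∀ x, ‖x - q x‖ ≤ D * (ε * (1 + ‖x‖) ^ (1 + δ / r)) := by
    intro x
    rcases hT x with h | ⟨a, ha, h⟩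
    · exact (hqle x 0 (Finset.mem_insert_self _ _)).trans (by simpa using h)
    · exact (hqle x a (Finset.mem_insert_of_mem ha)).trans h
  refine (quantizationError_rpow_le P hr hq hrange).trans ?_
  have hpt : ∀ x, ‖x - q x‖ₑ ^ r ≤ ENNReal.ofReal (D ^ r * ε ^ r * G x) := by
    intro x
    rw [← ofReal_norm, ENNReal.ofReal_rpow_of_nonneg (norm_nonneg _) hr.le]
    apply ENNReal.ofReal_le_ofReal
    calc ‖x - q x‖ ^ r ≤ (D * (ε * (1 + ‖x‖) ^ (1 + δ / r))) ^ r := by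
          gcongr
          exact hqb x
      _ = _ := by
        rw [Real.mul_rpow (by positivity) (by positivity), Real.mul_rpow (by positivity)
          (by positivity), ← Real.rpow_mul (x := 1 + ‖x‖) (by positivity), ← mul_assoc,
          show (1 + δ / r) * r = r + δ by field_simp]
  refine (lintegral_mono hpt).trans ?_
  rw [← ofReal_integral_eq_lintegral_ofReal (hGi.const_mul _)
    (Filter.Eventually.of_forall fun x => by positivity), integral_const_mul, ← hM, hεr]
  apply ENNReal.ofReal_le_ofReal
  have : 0 ≤ (n : ℝ) ^ (-(r / (d : ℝ))) := by positivity
  nlinarith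

theorem mul_rpow_neg_one_div_pow (A : ℝ) {x : ℝ} (hx : 0 < x) {d : ℕ} (hd : d ≠ 0) :
    (A * x ^ (-(1 / (d : ℝ)))) ^ d = A ^ d / x := by
  have hd' : (d : ℝ) ≠ 0 := by exact_mod_cast hd
  rw [mul_pow, ← Real.rpow_natCast (x ^ _), ← Real.rpow_mul hx.le, neg_mul,
    one_div_mul_cancel hd', Real.rpow_neg_one, div_eq_mul_inv]

theorem mul_rpow_neg_one_div_rpow {A x : ℝ} (hA : 0 ≤ A) (hx : 0 < x) (d r : ℝ) :
    (A * x ^ (-(1 / d))) ^ r = A ^ r * x ^ (-(r / d)) := by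
  rw [Real.mul_rpow hA (by positivity), ← Real.rpow_mul hx.le, neg_mul, one_div_mul_eq_div]

theorem rpow_neg_one_add {x : ℝ} (hx : 0 < x) (t : ℝ) :
    x ^ (-(1 + t)) = x ^ (-t) / x := by
  rw [show -(1 + t) = -t + -1 by ring, Real.rpow_add hx, Real.rpow_neg_one, div_eq_mul_inv]

/-! ### Lower bound: the gain from one more value -/

section

variable {E : Type*} [NormedAddCommGroup E] [NormedSpace ℝ E]
  [FiniteDimensional ℝ E] [MeasurableSpace E] [BorelSpace E]
  (lam : Measure E) [lam.IsAddHaarMeasure]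

theorem measure_biUnion_closedBall_le (T : Finset E) {s : ℝ} (hs : 0 ≤ s) :
    lam (⋃ a ∈ T, Metric.closedBall a s) ≤
      ENNReal.ofReal (T.card * s ^ Module.finrank ℝ E) * lam (Metric.ball 0 1) := by
  refine (measure_biUnion_finset_le _ _).trans ?_
  simp_rw [Measure.addHaar_closedBall lam _ hs]
  rw [Finset.sum_const, nsmul_eq_mul, ENNReal.ofReal_mul (by positivity), ENNReal.ofReal_natCast,
    mul_assoc]

theorem exists_card_mul_pow_le_imp_measure_biUnion_lt {t : ℝ≥0∞} (ht : t ≠ 0) :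
    ∃ κ : ℝ, 0 < κ ∧ ∀ (T : Finset E) (s : ℝ), 0 ≤ s → T.card * s ^ Module.finrank ℝ E ≤ κ →
      lam (⋃ a ∈ T, Metric.closedBall a s) < t := by
  set v := lam (Metric.ball (0 : E) 1) with hv
  have hv0 : v ≠ 0 := (Metric.measure_ball_pos lam _ one_pos).ne'
  have hvt : v ≠ ∞ := measure_ball_lt_top.ne
  have hpos : 0 < t / v := ENNReal.div_pos ht hvt
  obtain ⟨u, hu0, hu⟩ := exists_between hpos
  have hut : u ≠ ∞ := hu.ne_top
  refine ⟨u.toReal, ENNReal.toReal_pos hu0.ne' hut, fun T s hs hle => ?_⟩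
  calc _ ≤ ENNReal.ofReal (T.card * s ^ Module.finrank ℝ E) * v :=
        measure_biUnion_closedBall_le lam T hs
    _ ≤ u * v := by
        gcongr
        exact ENNReal.ofReal_le_of_le_toReal hle
    _ < t := by
        rw [ENNReal.lt_div_iff_mul_lt (Or.inl hv0) (Or.inl hvt)] at hu
        exact hu

/-- By Besicovitch differentiation, if every `K k` with `k ≠ 0` were null, the density of `P` would
vanish almost everywhere, contradicting `P ≪ lam`. -/
theorem exists_measure_closedBall_ge (P : Measure E) [IsProbabilityMeasure P] (hP : P ≪ lam) :
    ∃ (K : Set E) (c ρ₀ : ℝ), 0 < c ∧ 0 < ρ₀ ∧ lam K ≠ 0 ∧ ∀ y ∈ K, ∀ ρ, 0 < ρ → ρ ≤ ρ₀ →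
      ENNReal.ofReal (c * ρ ^ Module.finrank ℝ E) ≤ P (Metric.closedBall y ρ) := by
  have := FiniteDimensional.proper ℝ E
  let K : ℕ → Set E := fun k => {y | ∀ ρ : ℝ, 0 < ρ → ρ ≤ 1 / (k + 1) →
    (k : ℝ≥0∞)⁻¹ * lam (Metric.closedBall y ρ) ≤ P (Metric.closedBall y ρ)}
  obtain ⟨k, hk0, hk⟩ : ∃ k : ℕ, k ≠ 0 ∧ lam (K k) ≠ 0 := by
    by_contra! hcon
    have hae : ∀ᵐ y ∂lam, ∀ k : ℕ, k ≠ 0 → y ∉ K k := by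
      rw [ae_all_iff]
      intro k
      by_cases hk : k = 0
      · simp [hk]
      · filter_upwards [measure_eq_zero_iff_ae_notMem.1 (hcon k hk)] with y hy _ using hy
    have hzero : P.rnDeriv lam =ᵐ[lam] 0 := by
      filter_upwards [hae, Besicovitch.ae_tendsto_rnDeriv P lam] with y hy hlim
      by_contra hne
      obtain ⟨c, hc0, hc⟩ := exists_between (pos_iff_ne_zero.2 hne)
      have hev := hlim.eventually (lt_mem_nhds hc)
      rw [eventually_nhdsWithin_iff, Metric.eventually_nhds_iff] at hev
      obtain ⟨ρ₁, hρ₁, hev⟩ := hev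
      obtain ⟨k₁, hk₁⟩ := ENNReal.exists_inv_nat_lt hc0.ne'
      obtain ⟨k₂, hk₂⟩ := exists_nat_one_div_lt hρ₁
      refine hy (max (k₁ + 1) k₂) (by omega) fun ρ hρ hρle => ?_
      have hρlt : ρ < ρ₁ := by
        refine lt_of_le_of_lt (hρle.trans ?_) hk₂
        gcongr
        exact le_max_right _ _
      have h := hev (y := ρ) (by simpa [abs_of_pos hρ] using hρlt) hρ
      have hb0 : lam (Metric.closedBall y ρ) ≠ 0 := (Metric.measure_closedBall_pos lam _ hρ).ne'
      have hbt : lam (Metric.closedBall y ρ) ≠ ∞ := measure_closedBall_lt_top.ne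
      rw [ENNReal.lt_div_iff_mul_lt (Or.inl hb0) (Or.inl hbt)] at h
      refine le_trans ?_ h.le
      gcongr
      refine le_trans ?_ hk₁.le
      gcongr
      exact (Nat.le_succ _).trans (le_max_left _ _)
    have h1 := Measure.withDensity_rnDeriv_eq P lam hP
    rw [withDensity_congr_ae hzero, withDensity_zero] at h1
    exact IsProbabilityMeasure.ne_zero P h1.symm
  have hv0 : 0 < (lam (Metric.ball (0 : E) 1)).toReal :=
    ENNReal.toReal_pos (Metric.measure_ball_pos lam _ one_pos).ne' measure_ball_lt_top.ne
  have hk0' : (0 : ℝ) < k := by exact_mod_cast Nat.pos_of_ne_zero hk0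
  refine ⟨K k, (k : ℝ)⁻¹ * (lam (Metric.ball (0 : E) 1)).toReal, 1 / (k + 1), by positivity,
    by positivity, hk, fun y hy ρ hρ hρle => le_trans (le_of_eq ?_) (hy ρ hρ hρle)⟩
  rw [Measure.addHaar_closedBall lam _ hρ.le, ENNReal.ofReal_mul (by positivity),
    ENNReal.ofReal_mul (by positivity), ENNReal.ofReal_toReal measure_ball_lt_top.ne,
    ENNReal.ofReal_inv_of_pos hk0', ENNReal.ofReal_natCast]
  ring

theorem exists_add_quantizationError_succ_rpow_le [Nontrivial E] (P : Measure E)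
    [IsProbabilityMeasure P] (hP : P ≪ lam) {r : ℝ} (hr : 0 < r) :
    ∃ c : ℝ, 0 < c ∧ ∀ n : ℕ, 1 ≤ n →
      quantizationError P r (n + 1) ^ r +
        ENNReal.ofReal (c * (n : ℝ) ^ (-(1 + r / (Module.finrank ℝ E : ℝ)))) ≤
      quantizationError P r n ^ r := by
  classical
  set d := Module.finrank ℝ E with hd
  have hd0 : d ≠ 0 := (Module.finrank_pos (R := ℝ) (M := E)).ne'
  obtain ⟨K, c, ρ₀, hc, hρ₀, hK, hPK⟩ := exists_measure_closedBall_ge lam P hP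
  obtain ⟨κ, hκ, hfar⟩ := exists_card_mul_pow_le_imp_measure_biUnion_lt lam hK
  -- The bound by `ρ₀` makes the ball of radius `s / 4` admissible; the bound by `min κ 1` gives `A
  -- ^ d ≤ κ`.
  set A : ℝ := min ρ₀ (min κ 1) with hA
  have hA0 : 0 < A := by positivity
  have hAκ : A ^ d ≤ κ := by
    refine (pow_le_of_le_one hA0.le ?_ hd0).trans ?_
    · exact (min_le_right _ _).trans (min_le_right _ _)
    · exact (min_le_right _ _).trans (min_le_left _ _)
  -- Gain per unit `s ^ r`: on the ball around `y` the distance drops from at least `3s/4` to at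
  -- most `s/4`.
  set g : ℝ := (3 / 4) ^ r - (1 / 4) ^ r with hg
  have hg0 : 0 < g := sub_pos.2 (Real.rpow_lt_rpow (by norm_num) (by norm_num) hr)
  refine ⟨g * A ^ r * (c * (A / 4) ^ d), by positivity, fun n hn => ?_⟩
  have hn1 : (1 : ℝ) ≤ n := by exact_mod_cast hn
  have hn0 : (0 : ℝ) < n := by linarith
  rw [quantizationError_rpow P hr n]
  refine le_iInf fun q => le_iInf fun hq => le_iInf fun hcard => ?_
  have hfin : (Set.range q).Finite := Set.finite_of_encard_le_coe hcard
  set T := hfin.toFinset with hT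
  have hTcard : T.card ≤ n := by
    rw [hfin.encard_eq_coe_toFinset_card] at hcard
    exact_mod_cast hcard
  set s : ℝ := A * (n : ℝ) ^ (-(1 / (d : ℝ))) with hs
  have hs0 : 0 < s := by positivity
  have hsA : s ≤ A := by
    refine mul_le_of_le_one_right hA0.le (Real.rpow_le_one_of_one_le_of_nonpos hn1 ?_)
    rw [neg_nonpos]
    positivity
  have hsd : s ^ d = A ^ d / n := mul_rpow_neg_one_div_pow A hn0 hd0
  have hsr : s ^ r = A ^ r * (n : ℝ) ^ (-(r / (d : ℝ))) := mul_rpow_neg_one_div_rpow hA0.le hn0 d r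
  obtain ⟨y, hyK, hy⟩ : ∃ y ∈ K, ∀ a ∈ T, s < ‖y - a‖ := by
    have h := hfar T s hs0.le (by
      rw [← hd, hsd]
      calc (T.card : ℝ) * (A ^ d / n) ≤ n * (A ^ d / n) := by gcongr
        _ = A ^ d := by field_simp
        _ ≤ κ := hAκ)
    by_contra! hcon
    refine h.not_ge (measure_mono fun y hy => ?_)
    obtain ⟨a, ha, hle⟩ := hcon y hy
    simp only [Set.mem_iUnion]
    exact ⟨a, ha, by simpa [dist_eq_norm] using hle⟩
  set B := Metric.closedBall y (s / 4) with hB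
  have hBm : MeasurableSet B := Metric.isClosed_closedBall.measurableSet
  set q' : E → E := fun x => if x ∈ B then y else q x with hq'
  have hq'm : Measurable q' := Measurable.ite hBm measurable_const hq
  have hq'card : (Set.range q').encard ≤ ((n + 1 : ℕ) : ℕ∞) := by
    have hsub : Set.range q' ⊆ insert y (Set.range q) := by
      rintro _ ⟨x, rfl⟩
      simp only [hq']
      split_ifs <;> simp
    refine (Set.encard_le_encard hsub).trans ((Set.encard_insert_le _ _).trans ?_)
    push_cast
    gcongr
  have hpt : ∀ x, ‖x - q' x‖ₑ ^ r + B.indicator (fun _ => ENNReal.ofReal (g * s ^ r)) x ≤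
      ‖x - q x‖ₑ ^ r := by
    intro x
    by_cases hx : x ∈ B
    · have hxy : ‖x - y‖ ≤ s / 4 := by simpa [hB, dist_eq_norm] using hx
      have hxq : 3 / 4 * s ≤ ‖x - q x‖ := by
        have h1 := hy (q x) (by simp [hT])
        have h2 := norm_sub_le_norm_sub_add_norm_sub y x (q x)
        rw [norm_sub_rev y x] at h2
        linarith
      simp only [hq', if_pos hx, Set.indicator_of_mem hx]
      rw [← ofReal_norm, ← ofReal_norm, ENNReal.ofReal_rpow_of_nonneg (norm_nonneg _) hr.le,
        ENNReal.ofReal_rpow_of_nonneg (norm_nonneg _) hr.le,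
        ← ENNReal.ofReal_add (by positivity) (by positivity)]
      apply ENNReal.ofReal_le_ofReal
      calc ‖x - y‖ ^ r + g * s ^ r ≤ (1 / 4 * s) ^ r + g * s ^ r := by
            gcongr
            linarith
        _ = (3 / 4 * s) ^ r := by
            rw [Real.mul_rpow (by norm_num) hs0.le, Real.mul_rpow (by norm_num) hs0.le, hg]
            ring
        _ ≤ ‖x - q x‖ ^ r := by gcongr
    · simp [hq', hx]
  refine le_trans ?_ (lintegral_mono hpt)
  rw [lintegral_add_right _ (measurable_const.indicator hBm), lintegral_indicator_const hBm]
  refine add_le_add (quantizationError_rpow_le P hr hq'm hq'card) ?_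
  have hPB := hPK y hyK (s / 4) (by positivity) (by
    have : A ≤ ρ₀ := min_le_left _ _
    linarith)
  calc _ = ENNReal.ofReal (g * s ^ r) * ENNReal.ofReal (c * (s / 4) ^ d) := by
        rw [← ENNReal.ofReal_mul (by positivity), rpow_neg_one_add hn0, div_pow, div_pow, hsd, hsr]
        congr 1
        ring
    _ ≤ _ := by gcongr

end

/-! ### Upper bound: the cost of removing one value -/

section

variable {E : Type*} [NormedAddCommGroup E] [NormedSpace ℝ E]
  [FiniteDimensional ℝ E] [MeasurableSpace E] [BorelSpace E]
  (lam : Measure E) [lam.IsAddHaarMeasure]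

/-- If few values lie within `R`, their `s`-balls have `P`-mass below `1/4`, so at least half the
mass lies in a smaller ball and outside them. Values beyond `R` are at distance at least `1 ≥ s`
from that smaller ball. -/
theorem exists_half_rpow_le_lintegral (P : Measure E) [IsProbabilityMeasure P] (hP : P ≪ lam)
    {r : ℝ} (hr : 0 < r) :
    ∃ R κ : ℝ, 0 < R ∧ 0 < κ ∧ ∀ (q : E → E) (T : Finset E), (∀ x, q x ∈ T) →
      ∀ s : ℝ, 0 < s → s ≤ 1 →
      ((T.filter fun a => ‖a‖ ≤ R).card : ℝ) * s ^ Module.finrank ℝ E ≤ κ →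
      ENNReal.ofReal (s ^ r / 2) ≤ ∫⁻ x, ‖x - q x‖ₑ ^ r ∂P := by
  obtain ⟨t, ht0, ht⟩ : ∃ t > 0, ∀ A, lam A < t → P A < ENNReal.ofReal (1 / 4) := by
    obtain ⟨t, ht0, ht⟩ := exists_pos_setLIntegral_lt_of_measure_lt
      (μ := lam) (f := P.rnDeriv lam) (Measure.lintegral_rnDeriv_lt_top P lam).ne
      (ε := ENNReal.ofReal (1 / 4)) (by simp)
    exact ⟨t, ht0, fun A hA => by simpa only [Measure.setLIntegral_rnDeriv hP] using ht A hA⟩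
  obtain ⟨κ, hκ, hsmall⟩ := exists_card_mul_pow_le_imp_measure_biUnion_lt lam ht0.ne'
  obtain ⟨N, hN⟩ : ∃ N : ℕ, ENNReal.ofReal (3 / 4) < P (Metric.closedBall 0 N) := by
    have hmono : Monotone fun n : ℕ => Metric.closedBall (0 : E) n := fun a b hab =>
      Metric.closedBall_subset_closedBall (by exact_mod_cast hab)
    have h := tendsto_measure_iUnion_atTop (μ := P) hmono
    rw [Metric.iUnion_closedBall_nat, measure_univ] at h
    exact (h.eventually (lt_mem_nhds (ENNReal.ofReal_lt_one.2 (by norm_num)))).exists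
  refine ⟨N + 1, κ, by positivity, hκ, fun q T hqT s hs hs1 hle => ?_⟩
  set S := T.filter fun a => ‖a‖ ≤ (N : ℝ) + 1 with hS
  set U := ⋃ a ∈ S, Metric.closedBall a s with hU
  have hUm : MeasurableSet U :=
    Finset.measurableSet_biUnion _ fun a _ => Metric.isClosed_closedBall.measurableSet
  set B := Metric.closedBall (0 : E) N with hB
  have hBm : MeasurableSet B := Metric.isClosed_closedBall.measurableSet
  have hPU : P U < ENNReal.ofReal (1 / 4) := ht U (hsmall S s hs.le hle)
  have hhalf : ENNReal.ofReal (1 / 2) ≤ P (B \ U) := by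
    refine le_trans (ENNReal.le_sub_of_add_le_right hPU.ne_top ?_) le_measure_sdiff
    calc ENNReal.ofReal (1 / 2) + P U ≤ ENNReal.ofReal (1 / 2) + ENNReal.ofReal (1 / 4) := by gcongr
      _ = ENNReal.ofReal (3 / 4) := by
        rw [← ENNReal.ofReal_add (by norm_num) (by norm_num)]
        norm_num
      _ ≤ P B := hN.le
  have hpt : ∀ x ∈ B \ U, ENNReal.ofReal (s ^ r) ≤ ‖x - q x‖ₑ ^ r := by
    rintro x ⟨hxB, hxU⟩
    have hx : s ≤ ‖x - q x‖ := by
      by_cases hqS : ‖q x‖ ≤ (N : ℝ) + 1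
      · by_contra! hlt
        refine hxU ?_
        simp only [hU, Set.mem_iUnion]
        exact ⟨q x, Finset.mem_filter.2 ⟨hqT x, hqS⟩, by simpa [dist_eq_norm] using hlt.le⟩
      · have h1 : ‖x‖ ≤ N := by simpa [hB] using hxB
        have h2 := norm_sub_norm_le (q x) x
        rw [norm_sub_rev] at h2
        linarith
    rw [← ofReal_norm, ENNReal.ofReal_rpow_of_nonneg (norm_nonneg _) hr.le]
    apply ENNReal.ofReal_le_ofReal
    gcongr
  calc ENNReal.ofReal (s ^ r / 2) = ENNReal.ofReal (s ^ r) * ENNReal.ofReal (1 / 2) := by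
        rw [← ENNReal.ofReal_mul (by positivity)]
        congr 1
        ring
    _ ≤ ENNReal.ofReal (s ^ r) * P (B \ U) := by gcongr
    _ = ∫⁻ x in B \ U, ENNReal.ofReal (s ^ r) ∂P := by rw [setLIntegral_const]
    _ ≤ ∫⁻ x in B \ U, ‖x - q x‖ₑ ^ r ∂P := setLIntegral_mono' (hBm.diff hUm) hpt
    _ ≤ _ := setLIntegral_le_lintegral _ _

/-- With `f a` a nearest other point, the balls of radius `‖a - f a‖ / 2` are disjoint and lie in
the ball of radius `2 * R`; compare volumes. -/
theorem exists_neighbor_sum_pow_le {T : Finset E} (hT : 2 ≤ T.card) {R : ℝ}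
    (hTR : ∀ a ∈ T, ‖a‖ ≤ R) :
    ∃ f : E → E, (∀ a ∈ T, f a ∈ T ∧ f a ≠ a) ∧
      ∑ a ∈ T, ‖a - f a‖ ^ Module.finrank ℝ E ≤ (4 * R) ^ Module.finrank ℝ E := by
  classical
  set lam : Measure E := Measure.addHaar
  set d := Module.finrank ℝ E with hd
  have hex : ∀ a : E, ∃ b, a ∈ T → b ∈ T ∧ b ≠ a ∧ ∀ b' ∈ T, b' ≠ a → ‖a - b‖ ≤ ‖a - b'‖ := by
    intro a
    by_cases ha : a ∈ T
    · have hne : (T.erase a).Nonempty := by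
        rw [← Finset.card_pos, Finset.card_erase_of_mem ha]
        omega
      obtain ⟨b, hb, hmin⟩ := Finset.exists_min_image _ (fun b => ‖a - b‖) hne
      rw [Finset.mem_erase] at hb
      exact ⟨b, fun _ => ⟨hb.2, hb.1, fun b' h h' => hmin b' (Finset.mem_erase.2 ⟨h', h⟩)⟩⟩
    · exact ⟨0, fun h => absurd h ha⟩
  choose f hf using hex
  refine ⟨f, fun a ha => ⟨(hf a ha).1, (hf a ha).2.1⟩, ?_⟩
  obtain ⟨a₀, ha₀⟩ : T.Nonempty := Finset.card_pos.1 (by omega)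
  have hR : 0 ≤ R := (norm_nonneg a₀).trans (hTR a₀ ha₀)
  have hv0 : 0 < lam.real (Metric.ball (0 : E) 1) :=
    ENNReal.toReal_pos (Metric.measure_ball_pos lam _ one_pos).ne' measure_ball_lt_top.ne
  have hle : ∀ a ∈ T, ‖a - f a‖ ≤ 2 * R := fun a ha => by
    linarith [norm_sub_le a (f a), hTR a ha, hTR _ (hf a ha).1]
  have hdisj : (T : Set E).PairwiseDisjoint fun a => Metric.ball a (‖a - f a‖ / 2) := by
    intro a ha b hb hab
    refine Metric.ball_disjoint_ball ?_
    rw [dist_eq_norm]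
    have h1 := (hf a ha).2.2 b hb hab.symm
    have h2 := (hf b hb).2.2 a ha hab
    rw [norm_sub_rev b a] at h2
    linarith
  have hsub : ⋃ a ∈ T, Metric.ball a (‖a - f a‖ / 2) ⊆ Metric.closedBall (0 : E) (2 * R) := by
    refine Set.iUnion₂_subset fun a ha x hx => ?_
    have h1 : ‖x - a‖ < ‖a - f a‖ / 2 := by simpa [dist_eq_norm] using hx
    have h2 := norm_sub_norm_le x a
    rw [mem_closedBall_zero_iff]
    linarith [hle a ha, hTR a ha]
  have hsum : ∑ a ∈ T, lam.real (Metric.ball a (‖a - f a‖ / 2)) ≤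
      lam.real (Metric.closedBall (0 : E) (2 * R)) := by
    rw [← measureReal_biUnion_finset hdisj (fun a _ => Metric.isOpen_ball.measurableSet)]
    exact measureReal_mono hsub measure_closedBall_lt_top.ne
  have hball : ∀ a ∈ T, lam.real (Metric.ball a (‖a - f a‖ / 2)) =
      ‖a - f a‖ ^ d * ((1 / 2) ^ d * lam.real (Metric.ball (0 : E) 1)) := by
    intro a ha
    have : 0 < ‖a - f a‖ := norm_pos_iff.2 (sub_ne_zero.2 (hf a ha).2.1.symm)
    rw [measureReal_def, Measure.addHaar_ball_of_pos lam _ (by positivity), ENNReal.toReal_mul,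
      ENNReal.toReal_ofReal (by positivity), ← measureReal_def, ← hd, div_eq_mul_one_div, mul_pow]
    ring
  rw [Finset.sum_congr rfl hball, ← Finset.sum_mul,
    Measure.addHaar_real_closedBall lam _ (by positivity), ← hd] at hsum
  have h4 : (4 * R) ^ d * ((1 / 2) ^ d * lam.real (Metric.ball (0 : E) 1)) =
      (2 * R) ^ d * lam.real (Metric.ball (0 : E) 1) := by
    rw [← mul_assoc, ← mul_pow]
    ring_nf
  rw [← h4] at hsum
  exact le_of_mul_le_mul_right hsum (by positivity)

theorem quantizationError_rpow_le_add [Nontrivial E] (P : Measure E) [IsProbabilityMeasure P]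
    {r : ℝ} (hr : 0 < r) {n : ℕ} {q : E → E} (hq : Measurable q)
    (hn : (Set.range q).encard ≤ ((n + 1 : ℕ) : ℕ∞)) {T : Finset E}
    (hTq : (T : Set E) ⊆ Set.range q) (hT : 2 ≤ T.card) {R : ℝ} (hR : 0 < R)
    (hTR : ∀ a ∈ T, ‖a‖ ≤ R) {J : ℝ} (hJ : 0 < J)
    (hqJ : ∫⁻ x, ‖x - q x‖ₑ ^ r ∂P ≤ ENNReal.ofReal J) :
    quantizationError P r n ^ r ≤ ∫⁻ x, ‖x - q x‖ₑ ^ r ∂P +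
      ENNReal.ofReal (2 ^ r * (3 * J / T.card + (3 * (4 * R) ^ Module.finrank ℝ E / T.card) ^
        (r / (Module.finrank ℝ E : ℝ)) * (3 / T.card))) := by
  classical
  have := FiniteDimensional.proper ℝ E
  set d := Module.finrank ℝ E with hd
  have hd0 : d ≠ 0 := (Module.finrank_pos (R := ℝ) (M := E)).ne'
  set m : ℝ := (T.card : ℝ) with hm
  have hm0 : 0 < m := by
    rw [hm]
    exact_mod_cast (by omega : 0 < T.card)
  obtain ⟨f, hf, hfsum⟩ := exists_neighbor_sum_pow_le hT hTR
  rw [← hd] at hfsum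
  let V : E → Set E := fun a => q ⁻¹' {a}
  have hVm : ∀ a, MeasurableSet (V a) := fun a => hq (measurableSet_singleton a)
  have hVd : (T : Set E).PairwiseDisjoint V := fun a _ b _ hab =>
    Disjoint.preimage q (Set.disjoint_singleton.2 hab)
  set L : E → ℝ≥0∞ := fun a => ∫⁻ x in V a, ‖x - a‖ₑ ^ r ∂P with hL
  have hLq : ∀ a, L a = ∫⁻ x in V a, ‖x - q x‖ₑ ^ r ∂P := fun a =>
    setLIntegral_congr_fun (hVm a) fun x hx => by
      have : q x = a := hx
      rw [this]
  have hLsum : ∑ a ∈ T, L a ≤ ENNReal.ofReal J := by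
    simp_rw [hLq]
    rw [← lintegral_biUnion_finset hVd fun a _ => hVm a]
    exact (setLIntegral_le_lintegral _ _).trans hqJ
  have hLt : ∀ a ∈ T, L a ≠ ∞ := fun a ha =>
    ((Finset.single_le_sum (fun _ _ => zero_le) ha).trans_lt
      (hLsum.trans_lt ENNReal.ofReal_lt_top)).ne
  have hLsum' : ∑ a ∈ T, (L a).toReal ≤ J := by
    rw [← ENNReal.toReal_sum hLt]
    exact ENNReal.toReal_le_of_le_ofReal hJ.le hLsum
  have hPsum : ∑ a ∈ T, P.real (V a) ≤ 1 := by
    rw [← measureReal_biUnion_finset hVd fun a _ => hVm a]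
    exact measureReal_le_one
  -- Each of the three normalized quantities sums to at most `1` over `T`, so one `a` makes all
  -- three at most `3 / m` at once.
  obtain ⟨a, haT, ha⟩ : ∃ a ∈ T, P.real (V a) + (L a).toReal / J +
      ‖a - f a‖ ^ d / (4 * R) ^ d ≤ 3 / m := by
    refine Finset.exists_le_of_sum_le (Finset.card_pos.1 (by omega)) ?_
    rw [Finset.sum_add_distrib, Finset.sum_add_distrib, ← Finset.sum_div, ← Finset.sum_div,
      Finset.sum_const, nsmul_eq_mul, ← hm, mul_div_cancel₀ _ hm0.ne']
    have h1 := (div_le_one hJ).2 hLsum'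
    have h2 := (div_le_one (by positivity)).2 hfsum
    linarith
  have hu0 : 0 ≤ P.real (V a) := measureReal_nonneg
  have hy0 : 0 ≤ (L a).toReal / J := by positivity
  have hz0 : 0 ≤ ‖a - f a‖ ^ d / (4 * R) ^ d := by positivity
  have hPa : P.real (V a) ≤ 3 / m := by linarith
  have hLa : (L a).toReal ≤ 3 * J / m := by
    have : (L a).toReal / J ≤ 3 / m := by linarith
    rw [div_le_iff₀ hJ] at this
    exact this.trans_eq (by ring)
  have hfa : ‖a - f a‖ ^ r ≤ (3 * (4 * R) ^ d / m) ^ (r / (d : ℝ)) := by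
    have h1 : ‖a - f a‖ ^ d ≤ 3 * (4 * R) ^ d / m := by
      have : ‖a - f a‖ ^ d / (4 * R) ^ d ≤ 3 / m := by linarith
      rw [div_le_iff₀ (by positivity)] at this
      exact this.trans_eq (by ring)
    calc ‖a - f a‖ ^ r = (‖a - f a‖ ^ d) ^ (r / (d : ℝ)) := by
          rw [← Real.rpow_natCast, ← Real.rpow_mul (norm_nonneg _)]
          congr 1
          field_simp
      _ ≤ _ := by gcongr
  set q' : E → E := fun x => if x ∈ V a then f a else q x with hq'
  have hq'm : Measurable q' := Measurable.ite (hVm a) measurable_const hq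
  have hq'card : (Set.range q').encard ≤ n := by
    have hsub : Set.range q' ⊆ Set.range q \ {a} := by
      rintro _ ⟨x, rfl⟩
      simp only [hq']
      split_ifs with h
      · exact ⟨hTq (hf a haT).1, (hf a haT).2⟩
      · exact ⟨⟨x, rfl⟩, h⟩
    refine (Set.encard_le_encard hsub).trans ?_
    have h1 := Set.encard_sdiff_singleton_add_one (hTq haT)
    rw [← h1] at hn
    push_cast at hn
    exact (ENat.add_le_add_iff_right (by simp)).1 hn
  refine (quantizationError_rpow_le P hr hq'm hq'card).trans ?_
  have hpt : ∀ x, ‖x - q' x‖ₑ ^ r ≤ ‖x - q x‖ₑ ^ r + (V a).indicator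
      (fun x => ENNReal.ofReal (2 ^ r) * ‖x - a‖ₑ ^ r +
        ENNReal.ofReal (2 ^ r * ‖a - f a‖ ^ r)) x := by
    intro x
    by_cases hx : x ∈ V a
    · simp only [hq', if_pos hx, Set.indicator_of_mem hx]
      refine le_trans ?_ le_add_self
      rw [← ofReal_norm, ← ofReal_norm, ENNReal.ofReal_rpow_of_nonneg (norm_nonneg _) hr.le,
        ENNReal.ofReal_rpow_of_nonneg (norm_nonneg _) hr.le,
        ← ENNReal.ofReal_mul (by positivity), ← ENNReal.ofReal_add (by positivity) (by positivity)]
      apply ENNReal.ofReal_le_ofReal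
      have h1 := norm_sub_le_norm_sub_add_norm_sub x a (f a)
      rcases le_total ‖x - a‖ ‖a - f a‖ with h | h
      · calc ‖x - f a‖ ^ r ≤ (2 * ‖a - f a‖) ^ r := by
              gcongr
              linarith
          _ = 2 ^ r * ‖a - f a‖ ^ r := Real.mul_rpow (by norm_num) (norm_nonneg _)
          _ ≤ _ := le_add_of_nonneg_left (by positivity)
      · calc ‖x - f a‖ ^ r ≤ (2 * ‖x - a‖) ^ r := by
              gcongr
              linarith
          _ = 2 ^ r * ‖x - a‖ ^ r := Real.mul_rpow (by norm_num) (norm_nonneg _)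
          _ ≤ _ := le_add_of_nonneg_right (by positivity)
    · simp [hq', hx]
  refine (lintegral_mono hpt).trans ?_
  rw [lintegral_add_left (by fun_prop), lintegral_indicator (hVm a),
    lintegral_add_right _ measurable_const, lintegral_const_mul _ (by fun_prop), setLIntegral_const]
  refine add_le_add le_rfl ?_
  change ENNReal.ofReal (2 ^ r) * L a + _ ≤ _
  rw [← ENNReal.ofReal_toReal (hLt a haT), ← ofReal_measureReal,
    ← ENNReal.ofReal_mul (by positivity), ← ENNReal.ofReal_mul (by positivity),
    ← ENNReal.ofReal_add (by positivity) (by positivity), mul_add, ← mul_assoc]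
  apply ENNReal.ofReal_le_ofReal
  gcongr

theorem exists_quantizationError_rpow_le_succ_add [Nontrivial E] (P : Measure E)
    [IsProbabilityMeasure P] (hP : P ≪ lam) {r δ : ℝ} (hr : 0 < r) (hδ : 0 < δ)
    (hmom : Integrable (fun x : E => ‖x‖ ^ (r + δ)) P) :
    ∃ C : ℝ, 0 < C ∧ ∀ n : ℕ, 1 ≤ n →
      quantizationError P r n ^ r ≤ quantizationError P r (n + 1) ^ r +
        ENNReal.ofReal (C * (n : ℝ) ^ (-(1 + r / (Module.finrank ℝ E : ℝ)))) := by
  classical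
  set d := Module.finrank ℝ E with hd
  have hd0 : d ≠ 0 := (Module.finrank_pos (R := ℝ) (M := E)).ne'
  obtain ⟨K, hK, hbound⟩ := exists_quantizationError_rpow_le P hr hδ hmom
  rw [← hd] at hbound
  obtain ⟨R, κ, hR, hκ, hfew⟩ := exists_half_rpow_le_lintegral lam P hP hr
  -- With this `A`, too few values near the origin would force error at least `s ^ r / 2 = 2 * (K +
  -- 1) * p`, above the available bound `(K + 1) * p`.
  set A : ℝ := (4 * (K + 1)) ^ (1 / r) with hA
  have hA0 : 0 < A := by positivity
  have hAr : A ^ r = 4 * (K + 1) := by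
    rw [hA, ← Real.rpow_mul (by positivity), one_div_mul_cancel hr.ne', Real.rpow_one]
  set c : ℝ := κ / A ^ d with hc
  have hc0 : 0 < c := by positivity
  set n₀ : ℝ := max (A ^ d) (2 / c) with hn₀
  have hn₀0 : 0 < n₀ := by positivity
  set C₁ : ℝ := 2 ^ r * (3 * (K + 1) / c + (3 * (4 * R) ^ d / c) ^ (r / (d : ℝ)) * (3 / c)) with hC₁
  have hC₁0 : 0 < C₁ := by positivity
  refine ⟨C₁ + 1 + K * n₀, by positivity, fun n hn => ?_⟩
  have hn1 : (1 : ℝ) ≤ n := by exact_mod_cast hn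
  have hn0 : (0 : ℝ) < n := by linarith
  rw [rpow_neg_one_add hn0]
  set p : ℝ := (n : ℝ) ^ (-(r / (d : ℝ))) with hp
  have hp0 : 0 < p := by positivity
  have hpn : p / n ≤ p := div_le_self hp0.le hn1
  -- For `n < n₀` the a priori bound suffices, at the price of the term `K * n₀` in the constant.
  rcases lt_or_ge (n : ℝ) n₀ with hlt | hge
  · refine (hbound n hn).trans (le_add_of_nonneg_of_le zero_le ?_)
    apply ENNReal.ofReal_le_ofReal
    calc K * p = K * n * (p / n) := by field_simp
      _ ≤ K * n₀ * (p / n) := by gcongr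
      _ ≤ (C₁ + 1 + K * n₀) * (p / n) := by
        gcongr
        linarith
  have hnA : A ^ d ≤ n := (le_max_left _ _).trans hge
  have hnc : 2 / c ≤ n := (le_max_right _ _).trans hge
  have hsucc : quantizationError P r (n + 1) ^ r ≤ ENNReal.ofReal (K * p) := by
    refine (hbound (n + 1) (by omega)).trans (ENNReal.ofReal_le_ofReal ?_)
    gcongr K * ?_
    refine Real.rpow_le_rpow_of_nonpos hn0 (by push_cast; linarith) ?_
    rw [neg_nonpos]
    positivity
  -- No minimizer is needed: a slack of `p / n` already has the target order and is the `+ 1` in the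
  -- constant.
  obtain ⟨q, hq, hqn, hqlt⟩ := exists_lintegral_lt_of_quantizationError_rpow_lt P hr
    (ENNReal.lt_add_right (hsucc.trans_lt ENNReal.ofReal_lt_top).ne
      (ENNReal.ofReal_pos.2 (div_pos hp0 hn0)).ne')
  have hqJ : ∫⁻ x, ‖x - q x‖ₑ ^ r ∂P ≤ ENNReal.ofReal ((K + 1) * p) := by
    refine hqlt.le.trans ((add_le_add hsucc le_rfl).trans ?_)
    rw [← ENNReal.ofReal_add (by positivity) (by positivity)]
    apply ENNReal.ofReal_le_ofReal
    linarith
  have hfin : (Set.range q).Finite := Set.finite_of_encard_le_coe hqn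
  set T := hfin.toFinset.filter fun a => ‖a‖ ≤ R with hT
  set s : ℝ := A * (n : ℝ) ^ (-(1 / (d : ℝ))) with hs
  have hs0 : 0 < s := by positivity
  have hsd : s ^ d = A ^ d / n := mul_rpow_neg_one_div_pow A hn0 hd0
  have hsr : s ^ r = A ^ r * p := mul_rpow_neg_one_div_rpow hA0.le hn0 d r
  have hs1 : s ≤ 1 := by
    rw [← pow_le_one_iff_of_nonneg hs0.le hd0, hsd]
    exact (div_le_one hn0).2 hnA
  have hcard : c * n < T.card := by
    by_contra! hcon
    have h := (hfew q hfin.toFinset (by simp) s hs0 hs1 (by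
      rw [← hd, hsd, ← hT]
      calc (T.card : ℝ) * (A ^ d / n) ≤ c * n * (A ^ d / n) := by gcongr
        _ = κ := by
          rw [hc]
          field_simp)).trans hqJ
    rw [ENNReal.ofReal_le_ofReal_iff (by positivity), hsr, hAr] at h
    nlinarith
  have hcard2 : 2 ≤ T.card := by
    have : (2 : ℝ) < T.card := by
      refine lt_of_le_of_lt ?_ hcard
      rwa [div_le_iff₀' hc0] at hnc
    exact_mod_cast this.le
  have hcn0 : 0 < c * n := by positivity
  refine (quantizationError_rpow_le_add P hr hq hqn (T := T) (fun a ha => ?_) hcard2 hR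
    (fun a ha => (Finset.mem_filter.1 ha).2) (by positivity) hqJ).trans ?_
  · have := (Finset.mem_filter.1 (Finset.mem_coe.1 ha)).1
    simpa using this
  refine (add_le_add hqlt.le le_rfl).trans ?_
  rw [add_assoc, ← ENNReal.ofReal_add (by positivity) (by positivity), ← hd]
  refine add_le_add le_rfl (ENNReal.ofReal_le_ofReal ?_)
  have hmain : 2 ^ r * (3 * ((K + 1) * p) / T.card + (3 * (4 * R) ^ d / T.card) ^
        (r / (d : ℝ)) * (3 / T.card)) ≤ C₁ * (p / n) := by
    calc _ ≤ 2 ^ r * (3 * ((K + 1) * p) / (c * n) + (3 * (4 * R) ^ d / (c * n)) ^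
        (r / (d : ℝ)) * (3 / (c * n))) := by gcongr
      _ = C₁ * (p / n) := by
        rw [← div_div (3 * (4 * R) ^ d), Real.div_rpow (by positivity) hn0.le, hC₁, hp,
          Real.rpow_neg hn0.le]
        have : (n : ℝ) ^ (r / (d : ℝ)) ≠ 0 := by positivity
        field_simp
  have : 0 ≤ K * n₀ * (p / n) := by positivity
  linarith

end

theorem proposition2p5 {E : Type*} [NormedAddCommGroup E] [NormedSpace ℝ E]
    [FiniteDimensional ℝ E] [MeasurableSpace E] [BorelSpace E]
    (d : ℕ) (hd : 1 ≤ d) (hE : Module.finrank ℝ E = d)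
    (lam : Measure E) [lam.IsAddHaarMeasure]
    (P : Measure E) [IsProbabilityMeasure P] (hP : P ≪ lam)
    (r : ℝ) (hr : 0 < r)
    (δ : ℝ) (hδ : 0 < δ) (hmom : Integrable (fun x : E => ‖x‖ ^ (r + δ)) P) :
    WeaklyAsymptotic
      (fun n : ℕ => (quantizationError P r n).toReal ^ r
        - (quantizationError P r (n + 1)).toReal ^ r)
      (fun n : ℕ => (n : ℝ) ^ (-(1 + r / (d : ℝ)))) := by
  have : Nontrivial E := Module.nontrivial_of_finrank_pos (R := ℝ) (by omega)
  obtain ⟨K, hK, hbound⟩ := exists_quantizationError_rpow_le P hr hδ hmom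
  obtain ⟨c, hc, hlow⟩ := exists_add_quantizationError_succ_rpow_le lam P hP hr
  obtain ⟨C, hC, hup⟩ := exists_quantizationError_rpow_le_succ_add lam P hP hr hδ hmom
  rw [hE] at hlow hup
  have hfin : ∀ n : ℕ, 1 ≤ n → quantizationError P r n ^ r ≠ ∞ := fun n hn =>
    ((hbound n hn).trans_lt ENNReal.ofReal_lt_top).ne
  refine ⟨c, C, hc, fun n hn => ?_⟩
  have hn0 : (0 : ℝ) < n := by exact_mod_cast hn
  have hb : 0 < (n : ℝ) ^ (-(1 + r / (d : ℝ))) := by positivity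
  rw [le_div_iff₀ hb, div_le_iff₀ hb]
  beta_reduce
  rw [ENNReal.toReal_rpow, ENNReal.toReal_rpow]
  have h1 := ENNReal.toReal_mono (hfin n hn) (hlow n hn)
  have h2 := ENNReal.toReal_mono
    (ENNReal.add_ne_top.2 ⟨hfin (n + 1) (by omega), ENNReal.ofReal_ne_top⟩) (hup n hn)
  rw [ENNReal.toReal_add (hfin (n + 1) (by omega)) ENNReal.ofReal_ne_top,
    ENNReal.toReal_ofReal (by positivity)] at h1 h2
  constructor <;> linarith
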